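/- Let $\kappa>\aleph_1$ be a regular cardinal. If $\mathsf{CP}(\kappa)$ holds, then $\square(\kappa)$ fails. Here the notions are as follows (cardinals are identified with initial ordinals, and an ordinal with the set of smaller ordinals). $\square(\kappa)$ asserts that there is a sequence $(C_\alpha:\alpha<\kappa)$ such that (i) for every limit $\alpha<\kappa$, $C_\alpha$ is a closed unbounded subset of $\alpha$; (ii) for all $\alpha,\beta<\kappa$, if $\alpha$ is a limit point of $C_\beta$, then $C_\alpha=C_\beta\cap\alpha$; (iii) there is no closed unbounded $C\subseteq\kappa$ such that for all $\alpha<\kappa$ there is $\beta$ with $\alpha\le\beta<\kappa$ and $C\cap\alpha=C_\beta\cap\alpha$; (iv) $C_{\beta+1}=\{\beta\}$ for all $\beta<\kappa$. A covering matrix for $\kappa$ is a family $(K(n,\beta):n<\omega,\ \beta<\kappa)$ of subsets of $\kappa$ such that (i) $\beta\subseteq\bigcup_{n<\omega}K(n,\beta)$ for all $\beta<\kappa$; (ii) $|K(n,\beta)|<\kappa$ for all $n<\omega$ and $\beta<\kappa$; (iii) $K(n,\beta)\subseteq K(m,\beta)$ for all $\beta<\kappa$ and $n<m<\omega$; (iv)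 for all $\gamma<\beta<\kappa$ and $n<\omega$ there is $m<\omega$ such that $K(n,\gamma)\subseteq K(m,\beta)$; (v) for every countable (possibly finite) $X\subseteq\kappa$ there is $\gamma_X<\kappa$ such that for all $\beta<\kappa$ and $n<\omega$ there is $m<\omega$ with $K(n,\beta)\cap X\subseteq K(m,\gamma_X)$. $\mathsf{CP}(\kappa)$ asserts that for every covering matrix $(K(n,\beta):n<\omega,\ \beta<\kappa)$ for $\kappa$ there is an unbounded set $A\subseteq\kappa$ such that every countably infinite subset of $A$ is contained in some $K(n,\beta)$. -/

import Mathlib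

open Set Cardinal Ordinal Order

universe u

/-- `C` is a closed unbounded subset of the ordinal `α = {ξ | ξ < α}`. -/
def IsClubIn (C : Set Ordinal.{u}) (α : Ordinal.{u}) : Prop :=
  C ⊆ Iio α ∧ IsClub {ξ : Iio α | (ξ : Ordinal.{u}) ∈ C}

/-- `A` is an unbounded subset of the ordinal `α = {ξ | ξ < α}`. -/
def IsUnboundedIn (A : Set Ordinal.{u}) (α : Ordinal.{u}) : Prop :=
  A ⊆ Iio α ∧ ∀ β < α, ∃ ξ ∈ A, β ≤ ξ

/-- `α` is a limit point of the set of ordinals `C` (in the order topology). -/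
def IsLimitPoint (α : Ordinal.{u}) (C : Set Ordinal.{u}) : Prop :=
  AccPt α (Filter.principal C)

/-- `(C α : α < κ)` is a sequence witnessing the square principle at `κ`. Values of `C` at ordinals
`≥ κ` are irrelevant. -/
structure IsSquareSequence (κ : Cardinal.{u}) (C : Ordinal.{u} → Set Ordinal.{u}) : Prop where
  club : ∀ α < κ.ord, IsSuccLimit α → IsClubIn (C α) α
  coherent : ∀ α < κ.ord, ∀ β < κ.ord, IsLimitPoint α (C β) → C α = C β ∩ Iio α
  no_thread : ¬ ∃ D : Set Ordinal.{u}, IsClubIn D κ.ord ∧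
    ∀ α < κ.ord, ∃ β < κ.ord, α ≤ β ∧ D ∩ Iio α = C β ∩ Iio α
  succ : ∀ β < κ.ord, C (succ β) = {β}

/-- The square principle `□(κ)`. -/
def SquarePrinciple (κ : Cardinal.{u}) : Prop :=
  ∃ C : Ordinal.{u} → Set Ordinal.{u}, IsSquareSequence κ C

/-- `[A]^θ`, the family of subsets of `A` of size exactly `θ`. -/
def subsetsOfSize (A : Set Ordinal.{u}) (θ : Cardinal.{u}) : Set (Set Ordinal.{u}) :=
  {X | X ⊆ A ∧ #X = Cardinal.lift.{u + 1} θ}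

/-- The family `D` is covered by the family `E`. -/
def IsCoveredBy (D E : Set (Set Ordinal.{u})) : Prop :=
  ∀ X ∈ D, ∃ Y ∈ E, X ⊆ Y

/-- `(K α β : α < θ, β < κ)` is a `θ`-covering matrix for `κ`. Values of `K` outside the index
range are irrelevant. -/
structure IsCoveringMatrix (κ θ : Cardinal.{u})
    (K : Ordinal.{u} → Ordinal.{u} → Set Ordinal.{u}) : Prop where
  subset : ∀ α < θ.ord, ∀ β < κ.ord, K α β ⊆ Iio κ.ord
  covers : ∀ β < κ.ord, ∀ ξ < β, ∃ α < θ.ord, ξ ∈ K α β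
  small : ∀ α < θ.ord, ∀ β < κ.ord, #(K α β) < Cardinal.lift.{u + 1} κ
  mono : ∀ β < κ.ord, ∀ η < θ.ord, ∀ α < η, K α β ⊆ K η β
  increasing : ∀ β < κ.ord, ∀ γ < β, ∀ α < θ.ord, ∃ η < θ.ord, K α γ ⊆ K η β
  coherent : ∀ X : Set Ordinal.{u}, X ⊆ Iio κ.ord → #X ≤ Cardinal.lift.{u + 1} θ →
    ∃ γ < κ.ord, ∀ β < κ.ord, ∀ η < θ.ord, ∃ α < θ.ord, K η β ∩ X ⊆ K α γ

/-- The family of all entries `K α β`, `α < θ`, `β < κ`, of the matrix `K`. -/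
def matrixEntries (κ θ : Cardinal.{u}) (K : Ordinal.{u} → Ordinal.{u} → Set Ordinal.{u}) :
    Set (Set Ordinal.{u}) :=
  {Y | ∃ α < θ.ord, ∃ β < κ.ord, Y = K α β}

/-- The covering property `CP(κ, θ)`. -/
def CoveringProperty (κ θ : Cardinal.{u}) : Prop :=
  ∀ K : Ordinal.{u} → Ordinal.{u} → Set Ordinal.{u}, IsCoveringMatrix κ θ K →
    ∃ A : Set Ordinal.{u}, IsUnboundedIn A κ.ord ∧
      IsCoveredBy (subsetsOfSize A θ) (matrixEntries κ θ K)

/-- The covering property `CP(κ) = CP(κ, ω)`. -/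
def CP (κ : Cardinal.{u}) : Prop :=
  CoveringProperty κ ℵ₀

/-! Given a square sequence, let `K n β` consist of the `ξ < β` whose walk from `β` has at most `n`
steps. By coherence of `C`, the walk lengths from two ordinals differ boundedly on common arguments
(`exists_walkLength_bound`), so `K` is a covering matrix. For `A` as in `CP κ`, walks from any one
`β` to points of `A` have bounded length. By regularity a single bound would serve unboundedly many
`β`, whereas the absence of a thread makes walk lengths unbounded on products of unbounded sets
(`walkLength_unbounded`). -/

/-- The number of steps of the minimal walk from `β` down to `ξ` along `C`. -/
noncomputable def walkLength (C : Ordinal.{u} → Set Ordinal.{u}) (ξ β : Ordinal.{u}) : ℕ :=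
  open scoped Classical in
  if h : (C β ∩ Ico ξ β).Nonempty then walkLength C ξ (sInf (C β ∩ Ico ξ β)) + 1 else 0
termination_by β
decreasing_by exact (csInf_mem h).2.2

theorem walkLength_of_nonempty {C : Ordinal.{u} → Set Ordinal.{u}} {ξ β : Ordinal.{u}}
    (h : (C β ∩ Ico ξ β).Nonempty) :
    walkLength C ξ β = walkLength C ξ (sInf (C β ∩ Ico ξ β)) + 1 := by
  rw [walkLength, dif_pos h]

theorem isLimitPoint_iff {α : Ordinal.{u}} {C : Set Ordinal.{u}} :
    IsLimitPoint α C ↔ α ≠ 0 ∧ ∀ t < α, (C ∩ Ioo t α).Nonempty :=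
  SuccOrder.accPt_principal.trans (by simp)

theorem IsClubIn.exists_ge {C : Set Ordinal.{u}} {α ξ : Ordinal.{u}} (h : IsClubIn C α)
    (hξ : ξ < α) : ∃ η ∈ C, ξ ≤ η := by
  obtain ⟨η, hη, hle⟩ := h.2.isCofinal ⟨ξ, hξ⟩
  exact ⟨η, hη, hle⟩

/-! ### Coherence of walk lengths -/

namespace IsSquareSequence

variable {κ : Cardinal.{u}} {C : Ordinal.{u} → Set Ordinal.{u}}

theorem inter_Ico_nonempty (hC : IsSquareSequence κ C) {ξ β : Ordinal.{u}} (hβ : β < κ.ord)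
    (hξ : ξ < β) : (C β ∩ Ico ξ β).Nonempty := by
  rcases Ordinal.zero_or_succ_or_isSuccLimit β with rfl | ⟨γ, rfl⟩ | hlim
  · exact absurd hξ not_lt_zero
  · refine ⟨γ, ?_, Order.lt_succ_iff.1 hξ, Order.lt_succ γ⟩
    rw [hC.succ γ ((Order.lt_succ γ).trans hβ)]
    exact mem_singleton γ
  · obtain ⟨η, hη, hle⟩ := (hC.club β hβ hlim).exists_ge hξ
    exact ⟨η, hη, hle, (hC.club β hβ hlim).1 hη⟩

theorem walkLength_eq (hC : IsSquareSequence κ C) {ξ β : Ordinal.{u}} (hβ : β < κ.ord)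
    (hξ : ξ < β) : walkLength C ξ β = walkLength C ξ (sInf (C β ∩ Ico ξ β)) + 1 :=
  walkLength_of_nonempty (hC.inter_Ico_nonempty hβ hξ)

/-- `C α` is an initial segment of `C β` unbounded in `α`, so both walks have the same first step.
-/
theorem walkLength_eq_of_isLimitPoint (hC : IsSquareSequence κ C) {ξ α β : Ordinal.{u}}
    (hβ : β < κ.ord) (hαβ : α < β) (hξ : ξ < α) (h : IsLimitPoint α (C β)) :
    walkLength C ξ β = walkLength C ξ α := by
  have hα := hαβ.trans hβ
  have hco := hC.coherent α hα β hβ h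
  rw [hC.walkLength_eq hβ (hξ.trans hαβ), hC.walkLength_eq hα hξ]
  have hne := hC.inter_Ico_nonempty hα hξ
  have hmem := csInf_mem hne
  have : sInf (C β ∩ Ico ξ β) = sInf (C α ∩ Ico ξ α) := by
    apply le_antisymm
    · refine csInf_le' ⟨?_, hmem.2.1, hmem.2.2.trans hαβ⟩
      exact (hco.subset hmem.1).1
    · refine le_csInf (hC.inter_Ico_nonempty hβ (hξ.trans hαβ)) fun η hη => ?_
      rcases lt_or_ge η α with hlt | hge
      · refine csInf_le' ⟨?_, hη.2.1, hlt⟩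
        rw [hco]
        exact ⟨hη.1, hlt⟩
      · exact hmem.2.2.le.trans hge
  rw [this]

/-- Below a limit `α`, the walk from `β` eventually factors through the walk from `α`. -/
theorem exists_walkLength_eq_add (hC : IsSquareSequence κ C) {α : Ordinal.{u}}
    (hα : IsSuccLimit α) (β : Ordinal.{u}) (hβ : β < κ.ord) (hαβ : α < β) :
    ∃ t < α, ∃ k : ℕ, (∀ ξ, t < ξ → ξ < α → walkLength C ξ β = walkLength C ξ α + k) ∧
      (k = 0 → IsLimitPoint α (C β)) := by
  induction β using WellFoundedLT.induction with
  | ind β ih =>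
    have hpos : 0 < α := hα.bot_lt
    by_cases hlim : IsLimitPoint α (C β)
    · exact ⟨0, hpos, 0, fun ξ _ hξ => hC.walkLength_eq_of_isLimitPoint hβ hαβ hξ hlim,
        fun _ => hlim⟩
    · have hgap : ∃ t < α, ¬ (C β ∩ Ioo t α).Nonempty := by
        by_contra! hcon
        exact hlim (isLimitPoint_iff.2 ⟨hpos.ne', hcon⟩)
      obtain ⟨t, ht, hgap⟩ := hgap
      -- `C β` misses the interval `(t, α)`, so the first step is the same for all `ξ` in it.
      have hstep : ∀ ξ, t < ξ → ξ < α →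
          walkLength C ξ β = walkLength C ξ (sInf (C β ∩ Ico α β)) + 1 := by
        intro ξ htξ hξ
        rw [hC.walkLength_eq hβ (hξ.trans hαβ)]
        have : C β ∩ Ico ξ β = C β ∩ Ico α β := by
          ext η
          refine ⟨fun h => ⟨h.1, ?_, h.2.2⟩, fun h => ⟨h.1, hξ.le.trans h.2.1, h.2.2⟩⟩
          by_contra! hlt
          exact hgap ⟨η, h.1, htξ.trans_le h.2.1, hlt⟩
        rw [this]
      obtain ⟨-, hle, hlt⟩ := csInf_mem (hC.inter_Ico_nonempty hβ hαβ)
      rcases hle.eq_or_lt with heq | hgt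
      · refine ⟨t, ht, 1, fun ξ h₁ h₂ => ?_, by simp⟩
        rw [hstep ξ h₁ h₂, ← heq]
      · obtain ⟨s, hs, k, hk, -⟩ := ih _ hlt (hlt.trans hβ) hgt
        refine ⟨max s t, max_lt hs ht, k + 1, fun ξ h₁ h₂ => ?_, by simp⟩
        rw [hstep ξ ((le_max_right _ _).trans_lt h₁) h₂,
          hk ξ ((le_max_left _ _).trans_lt h₁) h₂, add_assoc]

/-- Induction on `α`: at a limit, the factorization handles a tail of `α`, and the bound below `succ
t` handles the rest. -/
theorem exists_walkLength_bound_of_le (hC : IsSquareSequence κ C) (α : Ordinal.{u}) :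
    ∀ β < κ.ord, α ≤ β → ∃ c : ℕ, ∀ ξ < α, walkLength C ξ α ≤ walkLength C ξ β + c ∧
      walkLength C ξ β ≤ walkLength C ξ α + c := by
  induction α using WellFoundedLT.induction with
  | ind α ih =>
    intro β hβ hαβ
    have below : ∀ γ < α, ∃ c : ℕ, ∀ ξ < γ, walkLength C ξ α ≤ walkLength C ξ β + c ∧
        walkLength C ξ β ≤ walkLength C ξ α + c := by
      intro γ hγ
      obtain ⟨c, hc⟩ := ih γ hγ α (hαβ.trans_lt hβ) hγ.le
      obtain ⟨d, hd⟩ := ih γ hγ β hβ (hγ.le.trans hαβ)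
      refine ⟨c + d, fun ξ hξ => ?_⟩
      have := hc ξ hξ
      have := hd ξ hξ
      omega
    rcases hαβ.eq_or_lt with rfl | hlt
    · exact ⟨0, by simp⟩
    rcases Ordinal.zero_or_succ_or_isSuccLimit α with rfl | ⟨γ, rfl⟩ | hlim
    · exact ⟨0, fun ξ hξ => absurd hξ not_lt_zero⟩
    · obtain ⟨c, hc⟩ := below γ (Order.lt_succ γ)
      refine ⟨c + walkLength C γ (Order.succ γ) + walkLength C γ β, fun ξ hξ => ?_⟩
      rcases (Order.lt_succ_iff.1 hξ).eq_or_lt with rfl | hξ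
      · omega
      · have := hc ξ hξ
        omega
    · obtain ⟨t, ht, k, hk, -⟩ := hC.exists_walkLength_eq_add hlim β hβ hlt
      obtain ⟨c, hc⟩ := below (Order.succ t) (hlim.succ_lt ht)
      refine ⟨c + k, fun ξ hξ => ?_⟩
      rcases le_or_gt ξ t with hle | hgt
      · have := hc ξ (Order.lt_succ_iff.2 hle)
        omega
      · have := hk ξ hgt hξ
        omega

theorem exists_walkLength_bound (hC : IsSquareSequence κ C) {α β : Ordinal.{u}}
    (hα : α < κ.ord) (hβ : β < κ.ord) :
    ∃ c : ℕ, ∀ ξ < α, ξ < β → walkLength C ξ α ≤ walkLength C ξ β + c := by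
  rcases le_total α β with h | h
  · obtain ⟨c, hc⟩ := hC.exists_walkLength_bound_of_le α β hβ h
    exact ⟨c, fun ξ hξ _ => (hc ξ hξ).1⟩
  · obtain ⟨c, hc⟩ := hC.exists_walkLength_bound_of_le β α hα h
    exact ⟨c, fun ξ _ hξ => (hc ξ hξ).2⟩

/-! ### Threads and unboundedness of walk lengths -/

/-- Coherence of `C` along an unbounded set yields a thread. -/
theorem not_unbounded_coherent (hC : IsSquareSequence κ C) {G : Set Ordinal.{u}}
    (hG : IsUnboundedIn G κ.ord) (hκ : IsSuccLimit κ.ord) (hlim : ∀ δ ∈ G, IsSuccLimit δ)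
    (hcoh : ∀ γ ∈ G, ∀ δ ∈ G, γ ≤ δ → C γ = C δ ∩ Iio γ) : False := by
  have hsub : ∀ δ ∈ G, C δ ⊆ Iio δ := fun δ hδ => (hC.club δ (hG.1 hδ) (hlim δ hδ)).1
  have hD : ∀ δ ∈ G, (⋃ γ ∈ G, C γ) ∩ Iio δ = C δ := by
    intro δ hδ
    ext ξ
    simp only [mem_inter_iff, mem_iUnion, exists_prop]
    refine ⟨?_, fun h => ⟨⟨δ, hδ, h⟩, hsub δ hδ h⟩⟩
    rintro ⟨⟨γ, hγ, hξγ⟩, hξ⟩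
    rcases le_total γ δ with h | h
    · rw [hcoh γ hγ δ hδ h] at hξγ
      exact hξγ.1
    · rw [hcoh δ hδ γ hγ h]
      exact ⟨hξγ, hξ⟩
  have hsubD : (⋃ γ ∈ G, C γ) ⊆ Iio κ.ord :=
    iUnion₂_subset fun δ hδ => (hsub δ hδ).trans (Iio_subset_Iio (hG.1 hδ).le)
  refine hC.no_thread ⟨⋃ γ ∈ G, C γ, ⟨hsubD, ⟨?_, ?_⟩⟩, ?_⟩
  -- A supremum below `κ` lies below some `δ ∈ G`, where closure of `C δ` applies.
  · intro s hs hne _ x hx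
    obtain ⟨δ, hδ, hxδ⟩ := hG.2 (Order.succ x) (hκ.succ_lt x.2)
    have hxδ : (x : Ordinal) < δ := Order.succ_le_iff.1 hxδ
    have hclub := (hC.club δ (hG.1 hδ) (hlim δ hδ)).2
    have hlub : IsLUB {y : Iio δ | ∃ z ∈ s, (z : Ordinal) = y} ⟨x, hxδ⟩ := by
      constructor
      · rintro y ⟨z, hz, hzy⟩
        exact Subtype.coe_le_coe.1 (hzy ▸ Subtype.coe_le_coe.2 (hx.1 hz))
      · intro y hy
        have hub : (⟨y, (mem_Iio.1 y.2).trans (hG.1 hδ)⟩ : Iio κ.ord) ∈ upperBounds s := fun z hz =>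
          Subtype.coe_le_coe.1 (hy (a := ⟨z, (Subtype.coe_le_coe.2 (hx.1 hz)).trans_lt hxδ⟩)
            ⟨z, hz, rfl⟩)
        exact Subtype.coe_le_coe.1 (Subtype.coe_le_coe.2 (hx.2 hub) : (x : Ordinal) ≤ y)
    have hmem := hclub.isLUB_mem (t := {y : Iio δ | ∃ z ∈ s, (z : Ordinal) = y}) ?_ ?_ hlub
    · exact mem_iUnion₂.2 ⟨δ, hδ, hmem⟩
    · rintro y ⟨z, hz, hzy⟩
      change (y : Ordinal) ∈ C δ
      rw [← hD δ hδ]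
      refine ⟨?_, y.2⟩
      rw [← hzy]
      exact hs hz
    · obtain ⟨z, hz⟩ := hne
      exact ⟨⟨z, (Subtype.coe_le_coe.2 (hx.1 hz)).trans_lt hxδ⟩, z, hz, rfl⟩
  · intro x
    obtain ⟨δ, hδ, hxδ⟩ := hG.2 (Order.succ x) (hκ.succ_lt x.2)
    obtain ⟨η, hη, hle⟩ := (hC.club δ (hG.1 hδ) (hlim δ hδ)).exists_ge (Order.succ_le_iff.1 hxδ)
    exact ⟨⟨η, (mem_Iio.1 (hsub δ hδ hη)).trans (hG.1 hδ)⟩, mem_iUnion₂.2 ⟨δ, hδ, hη⟩, hle⟩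
  · intro α hα
    obtain ⟨δ, hδ, hle⟩ := hG.2 α hα
    refine ⟨δ, hG.1 hδ, hle, ?_⟩
    rw [← hD δ hδ, inter_assoc, inter_eq_right.2 (Iio_subset_Iio hle)]

/-- The walk length of a square sequence is unbounded on products of unbounded sets. -/
theorem walkLength_unbounded (hC : IsSquareSequence κ C) (hreg : κ.IsRegular) (hκ : ℵ₀ < κ)
    (n : ℕ) : ∀ A B : Set Ordinal.{u}, IsUnboundedIn A κ.ord → IsUnboundedIn B κ.ord →
      ¬ ∀ ξ ∈ A, ∀ β ∈ B, ξ < β → walkLength C ξ β ≤ n := by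
  have hκlim : IsSuccLimit κ.ord := isSuccLimit_ord hκ.le
  induction n with
  | zero =>
    intro A B hA hB h
    obtain ⟨ξ, hξ, -⟩ := hA.2 0 hreg.ord_pos
    obtain ⟨β, hβ, hle⟩ := hB.2 (Order.succ ξ) (hκlim.succ_lt (hA.1 hξ))
    have hlt := Order.succ_le_iff.1 hle
    have := h ξ hξ β hβ hlt
    rw [hC.walkLength_eq (hB.1 hβ) hlt] at this
    omega
  | succ n ih =>
    intro A B hA hB h
    -- By the induction hypothesis for `A ∩ Ioi t`, the `α` whose walks to that set take at most `n`
    -- steps are bounded.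
    have hstep : ∀ t < κ.ord, ∃ s < κ.ord, t < s ∧ (A ∩ Ioo t s).Nonempty ∧
        ∀ α < κ.ord, (∀ ξ ∈ A, t < ξ → ξ < α → walkLength C ξ α ≤ n) → α < s := by
      intro t ht
      obtain ⟨ξ, hξ, hle⟩ := hA.2 (Order.succ t) (hκlim.succ_lt ht)
      have htξ := Order.succ_le_iff.1 hle
      have hbd : ∃ b < κ.ord, ∀ α < κ.ord,
          (∀ ξ ∈ A, t < ξ → ξ < α → walkLength C ξ α ≤ n) → α < b := by
        by_contra! hcon
        refine ih (A ∩ Ioi t) {α | α < κ.ord ∧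
          ∀ ξ ∈ A, t < ξ → ξ < α → walkLength C ξ α ≤ n} ⟨fun x hx => hA.1 hx.1, fun β hβ => ?_⟩
          ⟨fun x hx => hx.1, fun β hβ => ?_⟩ fun ξ hξ α hα => hα.2 ξ hξ.1 hξ.2
        · obtain ⟨η, hη, hle⟩ := hA.2 (max β (Order.succ t)) (max_lt hβ (hκlim.succ_lt ht))
          exact ⟨η, ⟨hη, Order.succ_le_iff.1 ((le_max_right _ _).trans hle)⟩,
            (le_max_left _ _).trans hle⟩
        · obtain ⟨α, h₁, h₂, h₃⟩ := hcon β hβ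
          exact ⟨α, ⟨h₁, h₂⟩, h₃⟩
      obtain ⟨b, hb, hbd⟩ := hbd
      refine ⟨max (Order.succ ξ) b, max_lt (hκlim.succ_lt (hA.1 hξ)) hb, ?_, ⟨ξ, hξ, htξ, ?_⟩, ?_⟩
      · exact (htξ.trans (Order.lt_succ ξ)).trans_le (le_max_left _ _)
      · exact (Order.lt_succ ξ).trans_le (le_max_left _ _)
      · exact fun α h₁ h₂ => (hbd α h₁ h₂).trans_le (le_max_right _ _)
    choose! f hfκ hlt hfA hf using hstep
    -- Since `f` need not be monotone, only cofinally many `s < δ` are required to satisfy `f s ≤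
    -- δ`.
    let G : Set Ordinal.{u} := {δ | δ < κ.ord ∧ δ ≠ 0 ∧ ∀ t < δ, ∃ s < δ, t ≤ s ∧ f s ≤ δ}
    have hacc : ∀ δ ∈ G, IsLimitPoint δ A := by
      rintro δ ⟨hδ, h0, hcl⟩
      refine isLimitPoint_iff.2 ⟨h0, fun t ht => ?_⟩
      obtain ⟨s, hs, hts, hfs⟩ := hcl t ht
      obtain ⟨ξ, hξ, h₁, h₂⟩ := hfA s (hs.trans hδ)
      exact ⟨ξ, hξ, hts.trans_lt h₁, h₂.trans_le hfs⟩
    have hlimG : ∀ δ ∈ G, IsSuccLimit δ := fun δ hδ => AccPt.isSuccLimit (hacc δ hδ)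
    have hmain : ∀ δ ∈ G, ∀ β ∈ B, δ < β → IsLimitPoint δ (C β) := by
      rintro δ hδG β hβ hδβ
      obtain ⟨t, ht, k, hk, hk0⟩ :=
        hC.exists_walkLength_eq_add (hlimG δ hδG) β (hB.1 hβ) hδβ
      refine hk0 ?_
      -- If `k ≥ 1`, walks from `δ` to a tail of `A ∩ Iio δ` take at most `n` steps, so `δ < f s`,
      -- contrary to `f s ≤ δ`.
      by_contra hne
      obtain ⟨hδ, h0, hcl⟩ := hδG
      obtain ⟨s, hs, hts, hfs⟩ := hcl t ht
      refine (hf s (hs.trans hδ) δ hδ fun ξ hξ h₁ h₂ => ?_).not_ge hfs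
      have := hk ξ (hts.trans_lt h₁) h₂
      have := h ξ hξ β hβ (h₂.trans hδβ)
      omega
    refine hC.not_unbounded_coherent (G := G) ⟨fun δ hδ => hδ.1, fun a ha => ?_⟩ hκlim hlimG ?_
    · have hδ : nfp f a < κ.ord := nfp_lt_ord_of_isRegular hreg hκ.ne' hfκ ha
      have hit : ∀ m : ℕ, f^[m] a ≤ nfp f a := fun m => iterate_le_nfp f a m
      have hitlt : ∀ m : ℕ, f^[m] a < nfp f a := fun m => by
        have h1 := hit (m + 1)
        rw [Function.iterate_succ_apply'] at h1
        exact (hlt _ ((hit m).trans_lt hδ)).trans_le h1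
      refine ⟨nfp f a, ⟨hδ, (bot_le.trans_lt (hitlt 0)).ne', fun t ht => ?_⟩, hit 0⟩
      obtain ⟨m, hm⟩ := lt_nfp_iff.1 ht
      refine ⟨f^[m] a, hitlt m, hm.le, ?_⟩
      rw [← Function.iterate_succ_apply' f]
      exact hit (m + 1)
    -- Both `C γ` and `C δ` are initial segments of `C β` for any `β ∈ B` above `δ`.
    · intro γ hγ δ hδ hle
      obtain ⟨β, hβ, hδβ⟩ := hB.2 (Order.succ δ) (hκlim.succ_lt hδ.1)
      have hδβ := Order.succ_le_iff.1 hδβ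
      rw [hC.coherent γ hγ.1 β (hB.1 hβ) (hmain γ hγ β hβ (hle.trans_lt hδβ)),
        hC.coherent δ hδ.1 β (hB.1 hβ) (hmain δ hδ β hβ hδβ), inter_assoc,
        inter_eq_right.2 (Iio_subset_Iio hle)]

end IsSquareSequence

/-! ### The walk matrix and the covering property -/

/-- The covering matrix given by bounding the length of walks along `C`. -/
def walkMatrix (C : Ordinal.{u} → Set Ordinal.{u}) (α β : Ordinal.{u}) : Set Ordinal.{u} :=
  {ξ | ξ < β ∧ (walkLength C ξ β : Ordinal.{u}) ≤ α}

theorem exists_nat_of_lt_ord_aleph0 {α : Ordinal.{u}} (h : α < (ℵ₀ : Cardinal.{u}).ord) :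
    ∃ n : ℕ, α = n := by
  rwa [ord_aleph0, lt_omega0] at h

theorem natCast_lt_ord_aleph0 (n : ℕ) : (n : Ordinal.{u}) < (ℵ₀ : Cardinal.{u}).ord := by
  rw [ord_aleph0]
  exact natCast_lt_omega0 n

theorem iSup_nat_lt_ord {κ : Cardinal.{u}} (hreg : κ.IsRegular) (hκ : ℵ₀ < κ)
    {f : ℕ → Ordinal.{u}} (hf : ∀ n, f n < κ.ord) : ⨆ n, f n < κ.ord :=
  Ordinal.lift_iSup_lt_of_lt_cof (by simpa [hreg.cof_ord] using hκ) hf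

theorem exists_lt_ord_of_countable {κ : Cardinal.{u}} (hreg : κ.IsRegular) (hκ : ℵ₀ < κ)
    {X : Set Ordinal.{u}} (hX : X ⊆ Iio κ.ord) (hc : X.Countable) :
    ∃ γ < κ.ord, X ⊆ Iio γ := by
  rcases X.eq_empty_or_nonempty with rfl | hne
  · exact ⟨0, hreg.ord_pos, empty_subset _⟩
  · obtain ⟨f, rfl⟩ := hc.exists_eq_range hne
    refine ⟨Order.succ (⨆ n, f n), (isSuccLimit_ord hκ.le).succ_lt
      (iSup_nat_lt_ord hreg hκ fun n => hX (mem_range_self n)), ?_⟩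
    rintro _ ⟨n, rfl⟩
    exact Order.lt_succ_iff.2 (Ordinal.le_iSup f n)

/-- Serves both `increasing`, with `γ` the larger index, and `coherent`, with `γ` a bound of the
countable set. -/
theorem IsSquareSequence.walkMatrix_subset {κ : Cardinal.{u}} {C : Ordinal.{u} → Set Ordinal.{u}}
    (hC : IsSquareSequence κ C) {β γ η : Ordinal.{u}} (hβ : β < κ.ord) (hγ : γ < κ.ord)
    (hη : η < (ℵ₀ : Cardinal.{u}).ord) :
    ∃ α < (ℵ₀ : Cardinal.{u}).ord, walkMatrix C η β ∩ Iio γ ⊆ walkMatrix C α γ := by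
  obtain ⟨n, rfl⟩ := exists_nat_of_lt_ord_aleph0 hη
  obtain ⟨c, hc⟩ := hC.exists_walkLength_bound hγ hβ
  refine ⟨(n + c : ℕ), natCast_lt_ord_aleph0 _, ?_⟩
  rintro ξ ⟨⟨hξβ, hξ⟩, hξγ⟩
  have h₁ : walkLength C ξ β ≤ n := Nat.cast_le.1 hξ
  have h₂ := hc ξ hξγ hξβ
  exact ⟨hξγ, Nat.cast_le.2 (by omega)⟩

theorem IsSquareSequence.isCoveringMatrix {κ : Cardinal.{u}} {C : Ordinal.{u} → Set Ordinal.{u}}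
    (hC : IsSquareSequence κ C) (hreg : κ.IsRegular) (hκ : ℵ₀ < κ) :
    IsCoveringMatrix κ ℵ₀ (walkMatrix C) where
  subset := fun α _ β hβ ξ hξ => hξ.1.trans hβ
  covers := fun β _ ξ hξ => ⟨walkLength C ξ β, natCast_lt_ord_aleph0 _, hξ, le_rfl⟩
  small := fun α _ β hβ => by
    refine (mk_le_mk_of_subset (t := Iio β) fun ξ hξ => hξ.1).trans_lt ?_
    rw [Cardinal.mk_Iio_ordinal, Cardinal.lift_lt]
    exact lt_ord.1 hβ
  mono := fun β _ η _ α hαη ξ hξ => ⟨hξ.1, hξ.2.trans hαη.le⟩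
  increasing := fun β hβ γ hγ α hα => by
    obtain ⟨η, hη, hsub⟩ := hC.walkMatrix_subset (hγ.trans hβ) hβ hα
    exact ⟨η, hη, fun ξ hξ => hsub ⟨hξ, hξ.1.trans hγ⟩⟩
  coherent := fun X hX hcard => by
    obtain ⟨γ, hγ, hXγ⟩ := exists_lt_ord_of_countable hreg hκ hX
      (Cardinal.le_aleph0_iff_set_countable.1 (by simpa using hcard))
    refine ⟨γ, hγ, fun β hβ η hη => ?_⟩
    obtain ⟨α, hα, hsub⟩ := hC.walkMatrix_subset hβ hγ hη
    exact ⟨α, hα, fun ξ hξ => hsub ⟨hξ.1, hXγ hξ.2⟩⟩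

/-- If all countably infinite subsets of `A` are covered by the walk matrix, then walk lengths
from any fixed ordinal to elements of `A` are bounded. -/
theorem IsSquareSequence.exists_walkLength_le {κ : Cardinal.{u}}
    {C : Ordinal.{u} → Set Ordinal.{u}} (hC : IsSquareSequence κ C) {A : Set Ordinal.{u}}
    (hcov : IsCoveredBy (subsetsOfSize A ℵ₀) (matrixEntries κ ℵ₀ (walkMatrix C)))
    {β : Ordinal.{u}} (hβ : β < κ.ord) :
    ∃ n : ℕ, ∀ ξ ∈ A, ξ < β → walkLength C ξ β ≤ n := by
  by_contra! hcon
  choose x hxA hxβ hx using hcon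
  have hinf : (range x).Infinite := by
    intro hfin
    obtain ⟨m, hm⟩ := (hfin.image fun ξ => walkLength C ξ β).bddAbove
    exact (hx m).not_ge (hm ⟨x m, mem_range_self m, rfl⟩)
  have hcard : #(range x) = Cardinal.lift.{u + 1} (ℵ₀ : Cardinal.{u}) := by
    rw [Cardinal.lift_aleph0]
    exact le_antisymm (Cardinal.le_aleph0_iff_set_countable.2 (countable_range x))
      (Cardinal.infinite_iff.1 hinf.to_subtype)
  obtain ⟨Y, ⟨α, hα, γ, hγ, rfl⟩, hXY⟩ := hcov (range x) ⟨range_subset_iff.2 hxA, hcard⟩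
  obtain ⟨m, rfl⟩ := exists_nat_of_lt_ord_aleph0 hα
  obtain ⟨c, hc⟩ := hC.exists_walkLength_bound hβ hγ
  -- All of `range x` is within `m` steps of `γ`, hence within `m + c` of `β`; the point `x (m + c)`
  -- is not.
  obtain ⟨h₁, h₂⟩ := hXY (mem_range_self (m + c))
  have h₂ : walkLength C (x (m + c)) γ ≤ m := Nat.cast_le.1 h₂
  have h₃ := hc _ (hxβ (m + c)) h₁
  have h₄ := hx (m + c)
  omega

theorem mainTheorem6 (κ : Cardinal.{u}) (hreg : κ.IsRegular) (hκ : ℵ₁ < κ) (hCP : CP κ) :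
    ¬ SquarePrinciple κ := by
  rintro ⟨C, hC⟩
  have hκ₀ : ℵ₀ < κ := aleph0_lt_aleph_one.trans hκ
  obtain ⟨A, hA, hcov⟩ := hCP (walkMatrix C) (hC.isCoveringMatrix hreg hκ₀)
  have hbd : ∀ n : ℕ, ∃ b < κ.ord, ∀ β < κ.ord,
      (∀ ξ ∈ A, ξ < β → walkLength C ξ β ≤ n) → β < b := by
    intro n
    by_contra! hcon
    refine hC.walkLength_unbounded hreg hκ₀ n A
      {β | β < κ.ord ∧ ∀ ξ ∈ A, ξ < β → walkLength C ξ β ≤ n} hA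
      ⟨fun β hβ => hβ.1, fun b hb => ?_⟩ fun ξ hξ β hβ => hβ.2 ξ hξ
    obtain ⟨β, h₁, h₂, h₃⟩ := hcon b hb
    exact ⟨β, ⟨h₁, h₂⟩, h₃⟩
  choose b hb hlt using hbd
  -- The supremum of all `b n` is an ordinal below `κ` admitting no bound `n`.
  have hsup := iSup_nat_lt_ord hreg hκ₀ hb
  obtain ⟨n, hn⟩ := hC.exists_walkLength_le hcov hsup
  exact (hlt n _ hsup hn).not_ge (Ordinal.le_iSup b n)
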